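/- **Setting.** Let $\Omega, I$ be sets and $\bar\Omega=\Omega\times I$. Let $U$ be a family of subsets of $\bar\Omega$ containing $\varnothing$ and $\bar\Omega$, closed under finite unions and intersections, and ordered by reverse inclusion: $u\le v$ iff $v\subset u$. For $D\subset\bar\Omega$ put $D(i)=\{\omega:(\omega,i)\in D\}$. Let $\bar{\mathbb A}=(\bar{\mathscr A}_u:u\in U)$ be an increasing family of $\sigma$-algebras on $\Omega$ such that, for $s,t\in U$, $F\in\bar{\mathscr A}_s$ and $i\in I$, the sets $F\cap(s\setminus t)(i)$ and $F\cap\bigcup_{j\in I}(s\setminus t)(j)$ belong to $\bar{\mathscr A}_s\cap\bar{\mathscr A}_t$. Let $\mathscr F$ be the $\sigma$-algebra generated by $\bigcup_u\bar{\mathscr A}_u$. A *finitely additive supermartingale* is a family $\bar m=(\bar m_u:u\in U)$, where $\bar m_u$ is a bounded finitely additive real set function on $\bar{\mathscr A}_u$, $\bar m_\varnothing=0$, and $\bar m_v|_{\bar{\mathscr A}_u}\le\bar m_u$ whenever $u\le v$. Let $\bar{\mathscr E}$ be the set of all finite sums $f=\sum_n f_n\mathbf 1_{u_n}$ with $u_n\in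 U$ and $f_n$ bounded and $\bar{\mathscr A}_{u_n}$-measurable. Let $\bar{\mathscr E}^*$ be defined in the same way with $f_n$ bounded and $\mathscr F$-measurable. Let $\bar{\mathscr D}$ be the collection of finite families $d$ of pairs $(u,v)\in U\times U$ with $v\subset u$ and with the sets $u\setminus v$ pairwise disjoint. It is directed by refinement: $d\le d'$ if each $u\setminus v$ with $(u,v)\in d$ is a union of sets $u'\setminus v'$ with $(u',v')\in d'$. Fix a Banach limit $\mathrm{LIM}$ over $\bar{\mathscr D}$, that is, a positive linear functional on bounded real nets indexed by $\bar{\mathscr D}$ which assigns to convergent nets their limit. For a probability measure $P$ on $\mathscr F$, $d\in\bar{\mathscr D}$ and $f\in\bar{\mathscr E}^*$ put $$\bar{\mathscr P}^d_P(f)=\sum_{(u,v)\in d}P\Big(\inf_{i:(\omega,i)\in u\setminus v}f(\omega,i)\,\Big|\,\bar{\mathscr A}_u\Big)\mathbf 1_{u\setminus v},$$ where the conditional expectation is a version bounded by $\sup|f|$ and the infimum over the empty set is $0$. **Class $D_*$.** Let $\mathscr M^{uc}(\bar m)$ be the set of positive bounded finitely additive measures $\lambda$ on all subsets of $\bar\Omega$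 (identified with their integrals $f\mapsto\lambda(f)$ on bounded functions) such that $\lambda((F\times I)\cap u)=\bar m_u(F)$ for $u\in U$, $F\in\bar{\mathscr A}_u$, and such that $F\mapsto\lambda(F\times I)$ is countably additive on $\mathscr F$. The supermartingale $\bar m$ is of *class $D_*$* if there are $\lambda\in\mathscr M^{uc}(\bar m)$ and a probability $P$ on $\mathscr F$, with $\lambda(F\times I)=0$ whenever $F\in\mathscr F$ and $P(F)=0$, such that some $P$-compensator $\lambda^P$ of $\lambda$ belongs to $\mathscr M^{uc}(\bar m)$. Here a $P$-compensator of $\lambda$ is a positive bounded finitely additive measure $\lambda^P$ on all subsets of $\bar\Omega$ such that $\lambda^P=\lambda$ on $\bar{\mathscr E}$, $\lambda^P(F\times I)=0$ for all $F\in\mathscr F$ with $P(F)=0$, and $$\lambda^P(fg)=\mathrm{LIM}_{d\in\bar{\mathscr D}}\lambda^P\big(\bar{\mathscr P}^d_P(f)\,g\big)\qquad f\in\bar{\mathscr E}^*,\ g\in\bar{\mathscr E}.$$ **Theorem.** Let $\bar m$ be a finitely additive supermartingale of class $D_*$ on $\bar{\mathbb A}$. Then for some probability measure $P$ on $\mathscr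 F$ there exist $M\in L^1(\Omega,\mathscr F,P)$ and a process $\bar A=(\bar A_u:u\in U)$ such that: 1. $\bar m_u(F)=P\big((M-\bar A_u)\mathbf 1_F\big)$ for all $u\in U$, $F\in\bar{\mathscr A}_u$; 2. each $\bar A_u$ is $P$-integrable and $\bar{\mathscr A}_u$-measurable, and $P(0=\bar A_{\bar\Omega}\le\bar A_u\le\bar A_v)=1$ whenever $u\le v$; 3. (naturality) for every $f\in\bar{\mathscr E}^*$, $$P\int f\,d\bar A=\mathrm{LIM}_{d\in\bar{\mathscr D}}P\int\bar{\mathscr P}^d_P(f)\,d\bar A,$$ where $\int f\,d\bar A=\sum_{(u,v)\in d}f_{u,v}(\bar A_v-\bar A_u)$ if $f=\sum_{(u,v)\in d}f_{u,v}\mathbf 1_{u\setminus v}$ with $d\in\bar{\mathscr D}$ and $f_{u,v}$ bounded and $\mathscr F$-measurable. The identity is required for every such representation of $f$, and the net on the right is required to be bounded. For this $P$ the decomposition is unique up to modification: if $(M',\bar A')$ has the same properties, then $P(\bar A_u=\bar A'_u)=1$ for every $u\in U$ and $P(M=M')=1$. -/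

import Mathlib

open MeasureTheory Filter Topology

noncomputable section

namespace SetIndexed

/-! ### Bounded functions and positive finitely additive measures -/

/-- The algebra of all bounded real functions on a set `S`. -/
def BddFun (S : Type*) : Subalgebra ℝ (S → ℝ) where
  carrier := {f | ∃ C : ℝ, ∀ x, |f x| ≤ C}
  mul_mem' := by
    rintro f g ⟨C, hC⟩ ⟨D, hD⟩
    refine ⟨C * D, fun x => ?_⟩
    rw [Pi.mul_apply, abs_mul]
    exact mul_le_mul (hC x) (hD x) (abs_nonneg _) ((abs_nonneg _).trans (hC x))
  add_mem' := by
    rintro f g ⟨C, hC⟩ ⟨D, hD⟩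
    exact ⟨C + D, fun x => (abs_add_le _ _).trans (add_le_add (hC x) (hD x))⟩
  algebraMap_mem' := fun r => ⟨|r|, fun _ => le_of_eq rfl⟩

/-- The indicator function of a subset of `S`, as a bounded function. -/
def ind {S : Type*} (E : Set S) : BddFun S :=
  ⟨E.indicator 1, 1, fun x => by by_cases h : x ∈ E <;> simp [h]⟩

/-- Positive bounded finitely additive measures on the power set of `S`, identified with the
positive linear functionals `f ↦ λ(f) = ∫ f dλ` on the bounded functions on `S`; the measure of
a set `E` is `λ (ind E)`. -/
abbrev PosBa (S : Type*) : Type _ := BddFun S →ₚ[ℝ] ℝ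

/-! ### Index lattice and filtration -/

variable {Ω I : Type*}

/-- The family `U` of subsets of `Ω × I` contains the empty set and the whole space and is closed
under finite unions and intersections. -/
structure IsIndexLattice (U : Set (Set (Ω × I))) : Prop where
  empty_mem : ∅ ∈ U
  univ_mem : Set.univ ∈ U
  union_mem : ∀ u ∈ U, ∀ v ∈ U, u ∪ v ∈ U
  inter_mem : ∀ u ∈ U, ∀ v ∈ U, u ∩ v ∈ U

/-- The `i`-section `{ω | (ω, i) ∈ D}`. -/
def sec (D : Set (Ω × I)) (i : I) : Set Ω := {ω | (ω, i) ∈ D}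

/-- The projection `⋃ i, D(i)` of `D` on `Ω`. For `D = s \ t` this is the set `{s < t}`. -/
def proj (D : Set (Ω × I)) : Set Ω := ⋃ i, sec D i

/-- A filtration of `σ`-algebras on `Ω` indexed by `U`, where `U` is ordered by reverse inclusion
(`s ≤ t` iff `t ⊆ s`), for which the sections and the projection of `s \ t` are compatible
with the `σ`-algebras of index `s` and `t`. -/
structure SetFiltration (U : Set (Set (Ω × I))) where
  alg : U → MeasurableSpace Ω
  mono : ∀ s t : U, (t : Set (Ω × I)) ⊆ s → alg s ≤ alg t
  sec_mem : ∀ (s t : U) (F : Set Ω) (i : I), MeasurableSet[alg s] F →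
    MeasurableSet[alg s] (F ∩ sec ((s : Set (Ω × I)) \ t) i) ∧
      MeasurableSet[alg t] (F ∩ sec ((s : Set (Ω × I)) \ t) i)
  proj_mem : ∀ (s t : U) (F : Set Ω), MeasurableSet[alg s] F →
    MeasurableSet[alg s] (F ∩ proj ((s : Set (Ω × I)) \ t)) ∧
      MeasurableSet[alg t] (F ∩ proj ((s : Set (Ω × I)) \ t))

variable {U : Set (Set (Ω × I))}

/-- The `σ`-algebra `𝓕` generated by all the `σ`-algebras of the filtration. -/
abbrev SetFiltration.sigma (𝔸 : SetFiltration U) : MeasurableSpace Ω := ⨆ u, 𝔸.alg u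

/-! ### Finitely additive processes -/

/-- A finitely additive process: for each `u` a bounded finitely additive set function on the
`σ`-algebra of index `u`, null if `u = ∅`. (The values on other sets are irrelevant.) -/
structure FinAddProcess (𝔸 : SetFiltration U) where
  toFun : (u : U) → AddContent ℝ {F : Set Ω | MeasurableSet[𝔸.alg u] F}
  bounded : ∀ u, ∃ C : ℝ, ∀ F : Set Ω, MeasurableSet[𝔸.alg u] F → |toFun u F| ≤ C
  null_empty : ∀ u : U, (u : Set (Ω × I)) = ∅ → ∀ F : Set Ω, MeasurableSet[𝔸.alg u] F →
    toFun u F = 0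

/-- `m` is a supermartingale: `m_t ≤ m_s` on the `σ`-algebra of index `s` whenever `s ≤ t`. -/
def FinAddProcess.IsSupermartingale {𝔸 : SetFiltration U} (m : FinAddProcess 𝔸) : Prop :=
  ∀ s t : U, (t : Set (Ω × I)) ⊆ s → ∀ F : Set Ω, MeasurableSet[𝔸.alg s] F →
    m.toFun t F ≤ m.toFun s F

/-! ### Elementary processes -/

/-- `f = ∑ n, fₙ 1_{tₙ}`, a finite sum with `tₙ ∈ U` and `fₙ` bounded and `σ tₙ`-measurable. -/
def IsElementaryFor (σ : U → MeasurableSpace Ω) (f : Ω × I → ℝ) : Prop :=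
  ∃ (N : ℕ) (t : Fin N → U) (c : Fin N → BddFun Ω),
    (∀ n, Measurable[σ (t n)] (c n : Ω → ℝ)) ∧
      f = fun x => ∑ n, (t n : Set (Ω × I)).indicator (fun y => (c n : Ω → ℝ) y.1) x

/-- Elementary processes: the coefficient of `1_t` is measurable for the `σ`-algebra of
index `t`. -/
def IsElementary (𝔸 : SetFiltration U) (f : Ω × I → ℝ) : Prop := IsElementaryFor 𝔸.alg f

/-- The larger class of processes of the same form with coefficients merely `𝓕`-measurable. -/
def IsElementaryStar (𝔸 : SetFiltration U) (f : Ω × I → ℝ) : Prop :=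
  IsElementaryFor (fun _ : U => 𝔸.sigma) f

/-! ### Disjoint families, refinement, Banach limits -/

/-- The set `u \ v` attached to the pair `(u, v)`. -/
def diff (p : U × U) : Set (Ω × I) := (p.1 : Set (Ω × I)) \ p.2

/-- Finite disjoint families `{uₙ \ vₙ}` with `uₙ, vₙ ∈ U` and `vₙ ⊆ uₙ`. The pairs `(uₙ, vₙ)` are
recorded, since conditioning on a member of the family refers to `uₙ`. -/
def DisjFamily (U : Set (Set (Ω × I))) : Type _ :=
  {d : Finset (U × U) // (∀ p ∈ d, (p.2 : Set (Ω × I)) ⊆ p.1) ∧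
    (d : Set (U × U)).PairwiseDisjoint diff}

/-- `d ≤ d'` when `d'` refines `d`: each member of `d` is a union of members of `d'`. -/
instance : Preorder (DisjFamily U) where
  le d d' := ∀ p ∈ d.1, ∃ e ⊆ d'.1, diff p = ⋃ q ∈ e, diff q
  le_refl d p hp := ⟨{p}, by simpa using hp, by simp⟩
  le_trans d₁ d₂ d₃ h₁₂ h₂₃ p hp := by
    classical
    obtain ⟨e, he, hpe⟩ := h₁₂ p hp
    choose! g hg hgq using h₂₃
    refine ⟨e.biUnion g, ?_, ?_⟩
    · intro q hq
      obtain ⟨r, hr, hqr⟩ := Finset.mem_biUnion.1 hq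
      exact hg r (he hr) hqr
    · rw [hpe, Finset.set_biUnion_biUnion]
      exact Set.iUnion₂_congr fun q hq => hgq q (he hq)

/-- A Banach limit over the finite disjoint families directed by refinement: a positive linear
functional on the bounded nets that gives every convergent bounded net its limit. -/
structure BanachLimit (U : Set (Set (Ω × I))) where
  lim : BddFun (DisjFamily U) →ₚ[ℝ] ℝ
  lim_eq : ∀ (x : BddFun (DisjFamily U)) (a : ℝ),
    Tendsto (x : DisjFamily U → ℝ) atTop (𝓝 a) → lim x = a

/-! ### The approximate predictable projections -/

/-- `ω ↦ inf {b (ω, i) | (ω, i) ∈ D}` (equal to `0` where no such `i` exists). -/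
def fiberInf (b : Ω × I → ℝ) (D : Set (Ω × I)) (ω : Ω) : ℝ :=
  ⨅ i : {i : I // (ω, i) ∈ D}, b (ω, i)

/-- A version, bounded by `sup |b|`, of the conditional expectation under `P` of the infimum of `b`
over the fibres of `u \ v`, given the `σ`-algebra of index `u`. -/
def predCoeff (𝔸 : SetFiltration U) (P : Measure[𝔸.sigma] Ω) (b : BddFun (Ω × I)) (p : U × U)
    (ω : Ω) : ℝ :=
  max (-⨆ x, |(b : Ω × I → ℝ) x|)
    (min ((P[fiberInf (b : Ω × I → ℝ) (diff p) | 𝔸.alg p.1]) ω) (⨆ x, |(b : Ω × I → ℝ) x|))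

/-- The process
`∑_{(u,v) ∈ d} P(inf_{i ∈ u \ v} b(i) | 𝔸_u) 1_{u \ v}` on `Ω × I`. -/
def predApprox (𝔸 : SetFiltration U) (P : Measure[𝔸.sigma] Ω) (d : DisjFamily U)
    (b : BddFun (Ω × I)) : BddFun (Ω × I) :=
  ∑ p ∈ d.1, ⟨(diff p).indicator (fun x => predCoeff 𝔸 P b p x.1),
    ⨆ x, |(b : Ω × I → ℝ) x|, fun x => by
      have h0 : (0 : ℝ) ≤ ⨆ x, |(b : Ω × I → ℝ) x| := Real.iSup_nonneg fun _ => abs_nonneg _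
      by_cases hx : x ∈ diff p
      · rw [Set.indicator_of_mem hx, abs_le]
        exact ⟨le_max_left _ _, max_le (by linarith) (min_le_right _ _)⟩
      · rw [Set.indicator_of_notMem hx, abs_zero]
        exact h0⟩

/-! ### Doléans-Dade measures, compensators and the class `D_*` -/

/-- `λ` is a Doléans-Dade measure of `m`: `λ((F × I) ∩ u) = m_u(F)`. -/
def IsDoleansMeasure {𝔸 : SetFiltration U} (m : FinAddProcess 𝔸) (lam : PosBa (Ω × I)) : Prop :=
  ∀ (u : U) (F : Set Ω), MeasurableSet[𝔸.alg u] F →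
    lam (ind ((F ×ˢ (Set.univ : Set I)) ∩ u)) = m.toFun u F

/-- The marginal `F ↦ λ(F × I)` is countably additive on `𝓕`. -/
def HasCountablyAdditiveMarginal (𝔸 : SetFiltration U) (lam : PosBa (Ω × I)) : Prop :=
  ∀ F : ℕ → Set Ω, (∀ n, MeasurableSet[𝔸.sigma] (F n)) → Pairwise (Function.onFun Disjoint F) →
    HasSum (fun n => lam (ind (F n ×ˢ (Set.univ : Set I))))
      (lam (ind ((⋃ n, F n) ×ˢ (Set.univ : Set I))))

/-- The marginal `F ↦ λ(F × I)` vanishes on the sets in `𝓕` of `P`-measure zero. -/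
def MarginalAbsCont (𝔸 : SetFiltration U) (lam : PosBa (Ω × I)) (P : Measure[𝔸.sigma] Ω) : Prop :=
  ∀ F : Set Ω, MeasurableSet[𝔸.sigma] F → P F = 0 → lam (ind (F ×ˢ (Set.univ : Set I))) = 0

/-- `lam'` is a `P`-compensator of `lam`: it coincides with `lam` on the elementary processes, its
marginal vanishes on `P`-null sets and `lam'(f g) = LIM_d lam'(𝓟^d_P(f) g)`. -/
structure IsCompensator (𝔸 : SetFiltration U) (LIM : BanachLimit U) (P : Measure[𝔸.sigma] Ω)
    (lam lam' : PosBa (Ω × I)) : Prop where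
  eq_elementary : ∀ g : BddFun (Ω × I), IsElementary 𝔸 g → lam' g = lam g
  null : MarginalAbsCont 𝔸 lam' P
  lim_eq : ∀ f g : BddFun (Ω × I), IsElementaryStar 𝔸 f → IsElementary 𝔸 g →
    ∃ hb : (fun d : DisjFamily U => lam' (predApprox 𝔸 P d f * g)) ∈ BddFun (DisjFamily U),
      lam' (f * g) = LIM.lim ⟨_, hb⟩

/-- Class `D_*`: some Doléans-Dade measure of `m` with countably additive marginal has, for some
probability `P` on `𝓕` dominating that marginal, a `P`-compensator which is again a Doléans-Dade
measure of `m` with countably additive marginal. -/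
def FinAddProcess.IsClassDStar {𝔸 : SetFiltration U} (m : FinAddProcess 𝔸) (LIM : BanachLimit U) :
    Prop :=
  ∃ lam lam' : PosBa (Ω × I), ∃ P : Measure[𝔸.sigma] Ω, IsProbabilityMeasure P ∧
    (IsDoleansMeasure m lam ∧ HasCountablyAdditiveMarginal 𝔸 lam) ∧
    MarginalAbsCont 𝔸 lam P ∧
    IsCompensator 𝔸 LIM P lam lam' ∧
    (IsDoleansMeasure m lam' ∧ HasCountablyAdditiveMarginal 𝔸 lam')

/-! ### The Doob-Meyer decomposition -/

/-- `A` is a `P`-increasing process: `0 = A_{Ω × I} ≤ A_u ≤ A_v` almost surely if `u ≤ v`. -/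
def IsIncreasingProcess (𝔸 : SetFiltration U) (P : Measure[𝔸.sigma] Ω) (A : U → Ω → ℝ) : Prop :=
  ∀ w u v : U, (w : Set (Ω × I)) = Set.univ → (v : Set (Ω × I)) ⊆ u →
    ∀ᵐ ω ∂P, 0 = A w ω ∧ A w ω ≤ A u ω ∧ A u ω ≤ A v ω

/-- The pathwise integral `∑_{(u,v) ∈ d} c_{u,v} (A_v - A_u)` of
`∑_{(u,v) ∈ d} c_{u,v} 1_{u \ v}` with respect to `A`. -/
def elemIntegral (d : DisjFamily U) (c : U × U → Ω → ℝ) (A : U → Ω → ℝ) (ω : Ω) : ℝ :=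
  ∑ p ∈ d.1, c p ω * (A p.2 ω - A p.1 ω)

/-- `f = ∑_{(u,v) ∈ d} c_{u,v} 1_{u \ v}` with bounded `𝓕`-measurable coefficients. -/
def IsRepresentation (𝔸 : SetFiltration U) (f : Ω × I → ℝ) (d : DisjFamily U)
    (c : U × U → Ω → ℝ) : Prop :=
  (∀ p ∈ d.1, c p ∈ BddFun Ω ∧ Measurable[𝔸.sigma] (c p)) ∧
    f = fun x => ∑ p ∈ d.1, (diff p).indicator (fun y => c p y.1) x

/-- Naturality: `P ∫ f dA = LIM_d P ∫ 𝓟^d_P(f) dA` for all `f` in the class `IsElementaryStar`,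
the left-hand side being computed from any representation of `f`. -/
def IsNatural (𝔸 : SetFiltration U) (LIM : BanachLimit U) (P : Measure[𝔸.sigma] Ω)
    (A : U → Ω → ℝ) : Prop :=
  ∀ f : BddFun (Ω × I), IsElementaryStar 𝔸 f →
    ∃ hb : (fun d : DisjFamily U => ∫ ω, elemIntegral d (predCoeff 𝔸 P f) A ω ∂P) ∈
        BddFun (DisjFamily U),
      ∀ (d : DisjFamily U) (c : U × U → Ω → ℝ), IsRepresentation 𝔸 f d c →
        ∫ ω, elemIntegral d c A ω ∂P = LIM.lim ⟨_, hb⟩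

/-- `m_u(F) = P((M - A_u) 1_F)` for `F` in the `σ`-algebra of index `u`, where `M` is
`P`-integrable and `A` is an integrable, adapted, increasing and natural process. -/
structure IsDoobMeyer {𝔸 : SetFiltration U} (LIM : BanachLimit U) (m : FinAddProcess 𝔸)
    (P : Measure[𝔸.sigma] Ω) (M : Ω → ℝ) (A : U → Ω → ℝ) : Prop where
  integrable_M : Integrable M P
  integrable_A : ∀ u, Integrable (A u) P
  adapted : ∀ u, Measurable[𝔸.alg u] (A u)
  increasing : IsIncreasingProcess 𝔸 P A
  natural : IsNatural 𝔸 LIM P A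
  decomp : ∀ (u : U) (F : Set Ω), MeasurableSet[𝔸.alg u] F →
    m.toFun u F = ∫ ω, F.indicator (fun ω => M ω - A u ω) ω ∂P

end SetIndexed

end

open SetIndexed

/-! Let `L` be the compensator supplied by class $D_*$. Its marginal is countably additive and
vanishes on `P`-null sets. Both properties pass to the smaller functionals $h\mapsto L(h1_D)$ for
every $D\subset\Omega\times I$, so Radon–Nikodym gives each an integrable density. Let $M$ be the
density for $D=\Omega\times I$ and $B_u$ the one for $D=u^c$. Since `L` is a Doléans-Dade measure of
`m`, $\int_F(M-B_u)\,dP=L((F\times I)\cap u)=m_u(F)$ for $F\in\mathscr A_u$. Positivity of `L` makes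
$B$ increasing. Integrating $f$ pathwise against $B$ and then under `P` gives $L(f)$, so naturality
is the compensator identity with $g=1$.

What remains is adaptedness, as $B_u$ is a priori only $\mathscr F$-measurable. If $P(k|\mathscr
A_u)=0$ then $L(k1_{u^c})=0$ (`restrict_compl_eq_zero`): this number is the Banach limit of a net
that vanishes as soon as the family refines $\{u^c\}$. Such orthogonality forces $B_u=P(B_u|\mathscr
A_u)$ a.s. (`ae_eq_condExp_of_orthogonal`), and $A_u$ is taken to be this conditional expectation.

For uniqueness, integrals of bounded $\mathscr A_u$-measurable functions against $A_v-A_u$ depend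
only on `m`. The nets in the naturality condition therefore coincide for any two decompositions, and
testing with $1_F1_{u^c}$ identifies $A_u$. Finally $M=A_\varnothing$, because $m_\varnothing=0$ and
$\mathscr A_\varnothing=\mathscr F$. -/

noncomputable section

namespace SetIndexed

/-! ### Positive functionals on bounded functions -/

section Functionals

variable {S : Type*}

lemma coe_ind (E : Set S) : (ind E : S → ℝ) = E.indicator 1 := rfl

lemma PosBa.le (L : PosBa S) {f g : BddFun S} (h : ∀ x, (f : S → ℝ) x ≤ (g : S → ℝ) x) :
    L f ≤ L g :=
  OrderHomClass.mono L (show f ≤ g from h)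

lemma PosBa.nonneg (L : PosBa S) {f : BddFun S} (h : ∀ x, 0 ≤ (f : S → ℝ) x) : 0 ≤ L f :=
  L.map_nonneg (show (0 : BddFun S) ≤ f from h)

lemma PosBa.abs_apply_le (L : PosBa S) {f g : BddFun S}
    (h : ∀ x, |(f : S → ℝ) x| ≤ (g : S → ℝ) x) : |L f| ≤ L g := by
  rw [abs_le]
  constructor
  · rw [← map_neg]
    exact L.le fun x => (abs_le.1 (h x)).1
  · exact L.le fun x => (abs_le.1 (h x)).2

/-- A bounded function which vanishes off a null set is null. -/
lemma PosBa.eq_zero_of_null (L : PosBa S) {f : BddFun S} {N : Set S} (hN : L (ind N) = 0)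
    (hf : ∀ x, x ∉ N → (f : S → ℝ) x = 0) : L f = 0 := by
  obtain ⟨C, hC⟩ := f.2
  have h := L.abs_apply_le (f := f) (g := C • ind N) fun x => by
    change _ ≤ C * N.indicator (1 : S → ℝ) x
    by_cases hx : x ∈ N
    · simpa [hx] using hC x
    · simp [hx, hf x hx]
  rw [map_smul, hN, smul_zero] at h
  exact abs_eq_zero.1 (le_antisymm h (abs_nonneg _))

/-- A positive functional that represents the measure `ν` on measurable sets represents the
integral with respect to `ν` on bounded measurable functions. -/
lemma PosBa.eq_integral [MeasurableSpace S] (L : PosBa S) (ν : Measure S) [IsFiniteMeasure ν]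
    (hL : ∀ F : Set S, MeasurableSet F → L (ind F) = ν.real F) (h : BddFun S)
    (hh : Measurable (h : S → ℝ)) : L h = ∫ x, (h : S → ℝ) x ∂ν := by
  obtain ⟨C, hC⟩ := h.2
  have hint : Integrable (h : S → ℝ) ν :=
    Integrable.of_bound hh.aestronglyMeasurable C (ae_of_all _ hC)
  -- Both sides are Lipschitz for the sup norm, with constants `L 1` and `ν(S)`, and they agree on
  -- simple functions. Rounding `h` down to the grid of mesh `1/(n+1)` gives a simple function `g`
  -- within one mesh of `h`.
  have key : ∀ n : ℕ, |L h - ∫ x, (h : S → ℝ) x ∂ν| ≤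
      (L 1 + ν.real Set.univ) * (1 / ((n : ℝ) + 1)) := by
    intro n
    have hn : (0 : ℝ) < (n : ℝ) + 1 := by positivity
    set K : ℤ := ⌈C * (n + 1)⌉ + 1
    set E : ℤ → Set S := fun k => {x | ⌊(h : S → ℝ) x * (n + 1)⌋ = k}
    have hE : ∀ k, MeasurableSet (E k) := fun k =>
      (Int.measurable_floor.comp (hh.mul_const _)) (measurableSet_singleton k)
    set g : BddFun S := ∑ k ∈ Finset.Icc (-K) K, ((k : ℝ) / (n + 1)) • ind (E k)
    have hgE : (g : S → ℝ) = fun x =>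
        ∑ k ∈ Finset.Icc (-K) K, ((k : ℝ) / (n + 1)) * (E k).indicator (1 : S → ℝ) x := by
      ext x
      simp [g, coe_ind]
    have hEint : ∀ k ∈ Finset.Icc (-K) K,
        Integrable (fun x => ((k : ℝ) / (n + 1)) * (E k).indicator (1 : S → ℝ) x) ν := fun k _ =>
      ((integrable_const (1 : ℝ)).indicator (hE k)).const_mul _
    have hg : ∀ x, (g : S → ℝ) x = ⌊(h : S → ℝ) x * (n + 1)⌋ / (n + 1) := by
      intro x
      rw [hgE]
      beta_reduce
      rw [Finset.sum_eq_single ⌊(h : S → ℝ) x * (n + 1)⌋]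
      · simp [E]
      · intro k _ hk
        simp [E, Ne.symm hk]
      · intro hk
        refine absurd (Finset.mem_Icc.2 ⟨?_, ?_⟩) hk
        · rw [Int.le_floor]
          push_cast [K]
          have h2 := (abs_le.1 (hC x)).1
          have h3 := Int.le_ceil (C * ((n : ℝ) + 1))
          nlinarith
        · have h2 := (abs_le.1 (hC x)).2
          have : ⌊(h : S → ℝ) x * (n + 1)⌋ ≤ ⌈C * ((n : ℝ) + 1)⌉ :=
            (Int.floor_mono (mul_le_mul_of_nonneg_right h2 hn.le)).trans (Int.floor_le_ceil _)
          omega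
    have hclose : ∀ x, |(h : S → ℝ) x - (g : S → ℝ) x| ≤ 1 / ((n : ℝ) + 1) := by
      intro x
      rw [hg, abs_le]
      have h1 := Int.floor_le ((h : S → ℝ) x * (n + 1))
      have h2 := (Int.lt_floor_add_one ((h : S → ℝ) x * (n + 1))).le
      have h3 : (h : S → ℝ) x - ⌊(h : S → ℝ) x * (n + 1)⌋ / (n + 1) =
          ((h : S → ℝ) x * (n + 1) - ⌊(h : S → ℝ) x * (n + 1)⌋) / (n + 1) := by
        field_simp
      rw [h3]
      constructor
      · have : (0 : ℝ) ≤ ((h : S → ℝ) x * (n + 1) - ⌊(h : S → ℝ) x * (n + 1)⌋) / (n + 1) :=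
          div_nonneg (by linarith) hn.le
        have : (0 : ℝ) ≤ 1 / ((n : ℝ) + 1) := by positivity
        linarith
      · exact div_le_div_of_nonneg_right (by linarith) hn.le
    have hgint : Integrable (g : S → ℝ) ν := by
      rw [hgE]
      exact integrable_finsetSum _ hEint
    have hLg : L g = ∫ x, (g : S → ℝ) x ∂ν := by
      rw [hgE, integral_finsetSum _ hEint, map_sum]
      refine Finset.sum_congr rfl fun k _ => ?_
      rw [map_smul, hL _ (hE k), integral_const_mul, integral_indicator_one (hE k), smul_eq_mul]
    have h1 : |L h - L g| ≤ L 1 * (1 / ((n : ℝ) + 1)) := by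
      rw [← map_sub]
      refine (L.abs_apply_le (g := (1 / ((n : ℝ) + 1)) • (1 : BddFun S)) fun x => ?_).trans ?_
      · change |(h : S → ℝ) x - (g : S → ℝ) x| ≤ (1 / ((n : ℝ) + 1)) * 1
        rw [mul_one]
        exact hclose x
      · rw [map_smul, smul_eq_mul, mul_comm]
    have h2 : |∫ x, (g : S → ℝ) x ∂ν - ∫ x, (h : S → ℝ) x ∂ν| ≤
        ν.real Set.univ * (1 / ((n : ℝ) + 1)) := by
      rw [← integral_sub hgint hint, mul_comm, ← Real.norm_eq_abs]
      refine norm_integral_le_of_norm_le_const (ae_of_all _ fun x => ?_)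
      rw [Real.norm_eq_abs, abs_sub_comm]
      exact hclose x
    calc |L h - ∫ x, (h : S → ℝ) x ∂ν|
        = |(L h - L g) + (∫ x, (g : S → ℝ) x ∂ν - ∫ x, (h : S → ℝ) x ∂ν)| := by rw [hLg]; ring_nf
      _ ≤ _ := (abs_add_le _ _).trans (by rw [add_mul]; exact add_le_add h1 h2)
  have hlim : Tendsto (fun n : ℕ => (L 1 + ν.real Set.univ) * (1 / ((n : ℝ) + 1))) atTop (𝓝 0) := by
    simpa using (tendsto_one_div_add_atTop_nhds_zero_nat (𝕜 := ℝ)).const_mul (L 1 + ν.real Set.univ)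
  have h0 : |L h - ∫ x, (h : S → ℝ) x ∂ν| ≤ 0 := ge_of_tendsto' hlim key
  exact sub_eq_zero.1 (abs_eq_zero.1 (le_antisymm h0 (abs_nonneg _)))

/-- Countable additivity of `F ↦ L(F)` on the measurable sets. -/
def PosBa.IsCountablyAdditive [MeasurableSpace S] (L : PosBa S) : Prop :=
  ∀ F : ℕ → Set S, (∀ n, MeasurableSet (F n)) → Pairwise (Function.onFun Disjoint F) →
    HasSum (fun n => L (ind (F n))) (L (ind (⋃ n, F n)))

lemma ind_union {E F : Set S} (h : Disjoint E F) : ind (E ∪ F) = ind E + ind F := by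
  apply Subtype.ext
  change (E ∪ F).indicator (1 : S → ℝ) = E.indicator 1 + F.indicator 1
  exact Set.indicator_union_of_disjoint h 1

lemma PosBa.ind_biUnion (L : PosBa S) {F : ℕ → Set S}
    (hd : Pairwise (Function.onFun Disjoint F)) (s : Finset ℕ) :
    L (ind (⋃ n ∈ s, F n)) = ∑ n ∈ s, L (ind (F n)) := by
  induction s using Finset.induction_on with
  | empty => simp [show ind (∅ : Set S) = 0 from Subtype.ext (Set.indicator_empty _)]
  | insert a s ha ih =>
    rw [Finset.sum_insert ha, Finset.set_biUnion_insert, ind_union, map_add, ih]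
    exact Set.disjoint_iUnion₂_right.2 fun b hb => hd fun h => ha (h ▸ hb)

/-- Countable additivity passes to dominated functionals. -/
lemma PosBa.IsCountablyAdditive.of_le [MeasurableSpace S] {L L' : PosBa S}
    (hL : L.IsCountablyAdditive) (h : ∀ F : Set S, L' (ind F) ≤ L (ind F)) :
    L'.IsCountablyAdditive := by
  intro F hF hd
  -- Given finite additivity, countable additivity amounts to the mass of the tails tending to zero,
  -- and the tails of `L'` are dominated by those of `L`.
  have hsplit : ∀ (T : PosBa S) (s : Finset ℕ), T (ind (⋃ n, F n)) =
      (∑ n ∈ s, T (ind (F n))) + T (ind ((⋃ n, F n) \ ⋃ n ∈ s, F n)) := by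
    intro T s
    rw [← T.ind_biUnion hd, ← map_add, ← ind_union Set.disjoint_sdiff_right,
      Set.union_sdiff_cancel (Set.iUnion₂_subset fun n _ => Set.subset_iUnion F n)]
  have h1 : Tendsto (fun s : Finset ℕ => L (ind ((⋃ n, F n) \ ⋃ n ∈ s, F n))) atTop (𝓝 0) := by
    have := (hL F hF hd).const_sub (L (ind (⋃ n, F n)))
    rw [sub_self] at this
    refine this.congr fun s => ?_
    rw [hsplit L s]
    ring
  have h2 : Tendsto (fun s : Finset ℕ => L' (ind ((⋃ n, F n) \ ⋃ n ∈ s, F n))) atTop (𝓝 0) :=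
    squeeze_zero (fun s => L'.nonneg fun x => Set.indicator_nonneg (fun _ _ => zero_le_one) x)
      (fun s => h _) h1
  have h3 := h2.const_sub (L' (ind (⋃ n, F n)))
  rw [sub_zero] at h3
  refine h3.congr fun s => ?_
  rw [hsplit L' s]
  ring

/-- A countably additive functional which vanishes on the null sets of `P` has an integrable
density with respect to `P`. -/
lemma PosBa.exists_density [MeasurableSpace S] (L : PosBa S) (hL : L.IsCountablyAdditive)
    (P : Measure S) [IsFiniteMeasure P]
    (hP : ∀ F : Set S, MeasurableSet F → P F = 0 → L (ind F) = 0) :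
    ∃ D : S → ℝ, Measurable D ∧ Integrable D P ∧ ∀ h : BddFun S, Measurable (h : S → ℝ) →
      L h = ∫ x, (h : S → ℝ) x * D x ∂P := by
  have hpos : ∀ F : Set S, 0 ≤ L (ind F) := fun F =>
    L.nonneg fun x => Set.indicator_nonneg (fun _ _ => zero_le_one) x
  have h0 : L (ind ∅) = 0 := by
    rw [show ind (∅ : Set S) = 0 from Subtype.ext (Set.indicator_empty _), map_zero]
  let ν : Measure S := Measure.ofMeasurable (fun F _ => ENNReal.ofReal (L (ind F))) (by simp [h0])
    (fun F hF hd => by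
      rw [← (hL F hF hd).tsum_eq,
        ENNReal.ofReal_tsum_of_nonneg (fun n => hpos _) (hL F hF hd).summable])
  have hν : ∀ F : Set S, MeasurableSet F → ν F = ENNReal.ofReal (L (ind F)) := fun F hF =>
    Measure.ofMeasurable_apply F hF
  have hfin : IsFiniteMeasure ν := ⟨by rw [hν _ MeasurableSet.univ]; exact ENNReal.ofReal_lt_top⟩
  have hac : ν ≪ P := Measure.AbsolutelyContinuous.mk fun F hF h => by
    rw [hν F hF, hP F hF h, ENNReal.ofReal_zero]
  refine ⟨fun x => (ν.rnDeriv P x).toReal, (Measure.measurable_rnDeriv ν P).ennreal_toReal,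
    Measure.integrable_toReal_rnDeriv, fun h hh => ?_⟩
  rw [L.eq_integral ν (fun F hF => by
    rw [Measure.real, hν F hF, ENNReal.toReal_ofReal (hpos F)]) h hh, ← integral_rnDeriv_smul hac]
  simp only [smul_eq_mul, mul_comm]

end Functionals

/-! ### Conditional expectations -/

section CondExp

variable {S : Type*} {m m0 : MeasurableSpace S} {P : Measure S} [IsProbabilityMeasure P]

/-- Conditional expectation is self-adjoint: both sides equal the integral of `P[k | m] * P[B | m]`.
Boundedness of `k` keeps the products integrable. -/
lemma integral_condExp_mul_comm (hm : m ≤ m0) {k B : S → ℝ} (hB : Integrable B P)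
    (hk : Integrable k P) {C : ℝ} (hC : ∀ᵐ x ∂P, |k x| ≤ C) :
    ∫ x, (P[k | m]) x * B x ∂P = ∫ x, k x * (P[B | m]) x ∂P := by
  have hbd : ∀ᵐ x ∂P, |(P[k | m]) x| ≤ C :=
    ae_bdd_abs_condExp_of_ae_bdd_abs hC
  have h1 : Integrable (P[k | m] * B) P :=
    hB.bdd_mul (integrable_condExp.aestronglyMeasurable) hbd
  have h2 : Integrable (k * P[B | m]) P :=
    integrable_condExp.bdd_mul hk.aestronglyMeasurable hC
  calc ∫ x, (P[k | m]) x * B x ∂P = ∫ x, (P[P[k | m] * B | m]) x ∂P := (integral_condExp hm).symm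
    _ = ∫ x, (P[k | m]) x * (P[B | m]) x ∂P :=
        integral_congr_ae (condExp_mul_of_stronglyMeasurable_left stronglyMeasurable_condExp h1 hB)
    _ = ∫ x, (P[k * P[B | m] | m]) x ∂P :=
        (integral_congr_ae
          (condExp_mul_of_stronglyMeasurable_right stronglyMeasurable_condExp h2 hk)).symm
    _ = _ := integral_condExp hm

/-- An integrable function orthogonal to all bounded functions with vanishing conditional
expectation agrees almost everywhere with its own conditional expectation. -/
lemma ae_eq_condExp_of_orthogonal (hm : m ≤ m0) {B : S → ℝ} (hB : Integrable B P)
    (h : ∀ k : BddFun S, Measurable[m0] (k : S → ℝ) → P[(k : S → ℝ) | m] =ᵐ[P] 0 →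
      ∫ x, (k : S → ℝ) x * B x ∂P = 0) : B =ᵐ[P] P[B | m] := by
  refine hB.ae_eq_of_forall_setIntegral_eq _ _ integrable_condExp fun F hF _ => ?_
  let k : S → ℝ := F.indicator 1
  have hkm : Measurable k := measurable_one.indicator hF
  have hkb : ∀ x, |k x| ≤ 1 := fun x => by by_cases hx : x ∈ F <;> simp [k, hx]
  have hk : Integrable k P :=
    Integrable.of_bound hkm.aestronglyMeasurable 1 (ae_of_all _ hkb)
  -- The test function is `k - P[k | m]`. Its second term is bounded only almost everywhere, so it
  -- is truncated to a version bounded at every point.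
  let k' : S → ℝ := fun x => max (-1) (min ((P[k | m]) x) 1)
  have hbd : ∀ᵐ x ∂P, |(P[k | m]) x| ≤ 1 :=
    ae_bdd_abs_condExp_of_ae_bdd_abs (ae_of_all _ hkb)
  have hk' : k' =ᵐ[P] P[k | m] := hbd.mono fun x hx => by
    have := abs_le.1 hx
    simp [k', this.1, this.2]
  have hk'm : Measurable[m] k' :=
    measurable_const.max (stronglyMeasurable_condExp.measurable.min measurable_const)
  have hk'i : Integrable k' P := integrable_condExp.congr hk'.symm
  have hk'b : ∀ x, |k' x| ≤ 1 := fun x =>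
    abs_le.2 ⟨le_max_left _ _, max_le (by norm_num) (min_le_right _ _)⟩
  have h0 : P[k - k' | m] =ᵐ[P] 0 := by
    refine (condExp_sub hk hk'i m).trans ?_
    rw [condExp_of_stronglyMeasurable hm hk'm.stronglyMeasurable hk'i]
    filter_upwards [hk'] with x hx
    simp [hx]
  have h1 := h (⟨k, 1, hkb⟩ - ⟨k', 1, hk'b⟩) (hkm.sub (hk'm.mono hm le_rfl)) h0
  have h2 : ∫ x, k x * B x ∂P - ∫ x, k' x * B x ∂P = 0 := by
    rw [← h1, ← integral_sub (hB.bdd_mul hk.aestronglyMeasurable (ae_of_all _ hkb))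
      (hB.bdd_mul hk'i.aestronglyMeasurable (ae_of_all _ hk'b))]
    exact integral_congr_ae (ae_of_all _ fun x => (sub_mul _ _ _).symm)
  have h3 : ∫ x, k' x * B x ∂P = ∫ x, k x * (P[B | m]) x ∂P :=
    (integral_congr_ae (hk'.mono fun x hx => by simp only [hx])).trans
      (integral_condExp_mul_comm hm hB hk (ae_of_all _ hkb))
  have hind : ∀ g : S → ℝ, ∫ x in F, g x ∂P = ∫ x, k x * g x ∂P := fun g => by
    rw [← integral_indicator hF]
    exact integral_congr_ae (ae_of_all _ fun x => by by_cases hx : x ∈ F <;> simp [k, hx])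
  rw [hind, hind, ← h3]
  linarith

end CondExp

/-! ### Restrictions of functionals on `Ω × I` -/

section Restriction

variable {Ω I : Type*}

/-- A bounded function on `Ω`, regarded as a function on `Ω × I`. -/
def lift (I : Type*) (h : BddFun Ω) : BddFun (Ω × I) :=
  ⟨fun x => (h : Ω → ℝ) x.1, h.2.imp fun _ hC x => hC x.1⟩

lemma lift_apply (h : BddFun Ω) (x : Ω × I) : (lift I h : Ω × I → ℝ) x = (h : Ω → ℝ) x.1 := rfl

lemma lift_ind_mul_ind (F : Set Ω) (D : Set (Ω × I)) :
    lift I (ind F) * ind D = ind ((F ×ˢ (Set.univ : Set I)) ∩ D) := by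
  apply Subtype.ext
  ext x
  change F.indicator (1 : Ω → ℝ) x.1 * D.indicator 1 x = _
  by_cases h1 : x.1 ∈ F <;> by_cases h2 : x ∈ D <;> simp [coe_ind, h1, h2]

/-- The functional `h ↦ L(h 1_D)` on the bounded functions on `Ω`. -/
def PosBa.restrict (L : PosBa (Ω × I)) (D : Set (Ω × I)) : PosBa Ω where
  toFun h := L (lift I h * ind D)
  map_add' h k := by
    rw [← map_add, ← add_mul]
    rfl
  map_smul' r h := by
    rw [RingHom.id_apply, ← map_smul, ← smul_mul_assoc]
    rfl
  monotone' h k hhk := L.le fun x =>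
    mul_le_mul_of_nonneg_right (hhk x.1) (Set.indicator_nonneg (fun _ _ => zero_le_one) x)

lemma PosBa.restrict_apply (L : PosBa (Ω × I)) (D : Set (Ω × I)) (h : BddFun Ω) :
    L.restrict D h = L (lift I h * ind D) := rfl

lemma PosBa.restrict_ind (L : PosBa (Ω × I)) (D : Set (Ω × I)) (F : Set Ω) :
    L.restrict D (ind F) = L (ind ((F ×ˢ (Set.univ : Set I)) ∩ D)) := by
  rw [restrict_apply, lift_ind_mul_ind]

lemma PosBa.ind_mono {S : Type*} (L : PosBa S) {E F : Set S} (h : E ⊆ F) :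
    L (ind E) ≤ L (ind F) :=
  L.le fun x => Set.indicator_le_indicator_of_subset h (fun _ => zero_le_one) x

variable {U : Set (Set (Ω × I))} {𝔸 : SetFiltration U} {P : Measure[𝔸.sigma] Ω}

/-- `D` is arbitrary: restricting to `D` only decreases the values on indicators, so countable
additivity and nullity are inherited from the full marginal. -/
lemma PosBa.exists_restrict_density [IsFiniteMeasure P] {L : PosBa (Ω × I)}
    (hca : HasCountablyAdditiveMarginal 𝔸 L) (hac : MarginalAbsCont 𝔸 L P) (D : Set (Ω × I)) :
    ∃ B : Ω → ℝ, Measurable[𝔸.sigma] B ∧ Integrable B P ∧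
      ∀ h : BddFun Ω, Measurable[𝔸.sigma] (h : Ω → ℝ) →
        L.restrict D h = ∫ ω, (h : Ω → ℝ) ω * B ω ∂P := by
  let := 𝔸.sigma
  refine (L.restrict D).exists_density ?_ P fun F hF h0 => ?_
  · refine PosBa.IsCountablyAdditive.of_le (L := L.restrict Set.univ) (fun F hF hd => ?_)
      fun F => ?_
    · simpa only [PosBa.restrict_ind, Set.inter_univ] using hca F hF hd
    · rw [PosBa.restrict_ind, PosBa.restrict_ind]
      exact L.ind_mono (Set.inter_subset_inter_right _ (Set.subset_univ _))
  · rw [PosBa.restrict_ind]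
    exact le_antisymm ((L.ind_mono Set.inter_subset_left).trans (hac F hF h0).le)
      (L.nonneg fun x => Set.indicator_nonneg (fun _ _ => zero_le_one) x)

end Restriction

section Filtration

variable {Ω I : Type*} {U : Set (Set (Ω × I))}

lemma SetFiltration.le_sigma (𝔸 : SetFiltration U) (u : U) : 𝔸.alg u ≤ 𝔸.sigma :=
  le_iSup 𝔸.alg u

/-! ### Elementary processes and approximate projections -/

lemma isElementaryStar_lift (hU : IsIndexLattice U) (𝔸 : SetFiltration U) {k : BddFun Ω}
    (hk : Measurable[𝔸.sigma] (k : Ω → ℝ)) : IsElementaryStar 𝔸 (lift I k : Ω × I → ℝ) :=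
  ⟨1, fun _ => ⟨Set.univ, hU.univ_mem⟩, fun _ => k, fun _ => hk, by ext x; simp [lift_apply]⟩

lemma isElementaryStar_lift_mul_ind_compl (hU : IsIndexLattice U) (𝔸 : SetFiltration U)
    {k : BddFun Ω} (hk : Measurable[𝔸.sigma] (k : Ω → ℝ)) (u : U) :
    IsElementaryStar 𝔸 (lift I k * ind (u : Set (Ω × I))ᶜ : BddFun (Ω × I)) := by
  -- The complement of `u` need not lie in `U`, hence the form `k 1 - k 1_u`.
  refine ⟨2, ![⟨Set.univ, hU.univ_mem⟩, u], ![k, -k], fun n => ?_, ?_⟩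
  · fin_cases n
    · exact hk
    · exact @Measurable.neg _ _ _ _ _ 𝔸.sigma _ hk
  · ext x
    by_cases hx : x ∈ (u : Set (Ω × I)) <;> simp [lift_apply, coe_ind, hx]

lemma isElementary_one (hU : IsIndexLattice U) (𝔸 : SetFiltration U) :
    IsElementary 𝔸 (1 : BddFun (Ω × I)) :=
  ⟨1, fun _ => ⟨Set.univ, hU.univ_mem⟩, fun _ => 1, fun _ => measurable_const, by ext x; simp⟩

lemma isElementary_ind_compl (hU : IsIndexLattice U) (𝔸 : SetFiltration U) (u : U) :
    IsElementary 𝔸 (ind (u : Set (Ω × I))ᶜ : BddFun (Ω × I)) := by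
  refine ⟨2, ![⟨Set.univ, hU.univ_mem⟩, u], ![1, -1], fun n => ?_, ?_⟩
  · fin_cases n
    · exact @measurable_const _ _ _ (𝔸.alg _) (1 : ℝ)
    · exact @measurable_const _ _ _ (𝔸.alg _) (-1 : ℝ)
  · ext x
    by_cases hx : x ∈ (u : Set (Ω × I)) <;> simp [coe_ind, hx]

/-- The disjoint family with the single member `(Ω × I) \ u`. -/
def complFamily (hU : IsIndexLattice U) (u : U) : DisjFamily U :=
  ⟨{(⟨Set.univ, hU.univ_mem⟩, u)}, fun p hp => by
    rw [Finset.mem_singleton.1 hp]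
    exact Set.subset_univ _, by simp⟩

lemma predCoeff_abs_le (𝔸 : SetFiltration U) (P : Measure[𝔸.sigma] Ω) (b : BddFun (Ω × I))
    (p : U × U) (ω : Ω) : |predCoeff 𝔸 P b p ω| ≤ ⨆ x, |(b : Ω × I → ℝ) x| := by
  have h0 : (0 : ℝ) ≤ ⨆ x, |(b : Ω × I → ℝ) x| := Real.iSup_nonneg fun _ => abs_nonneg _
  exact abs_le.2 ⟨le_max_left _ _, max_le (by linarith) (min_le_right _ _)⟩

lemma measurable_predCoeff (𝔸 : SetFiltration U) (P : Measure[𝔸.sigma] Ω) (b : BddFun (Ω × I))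
    (p : U × U) : Measurable[𝔸.alg p.1] (predCoeff 𝔸 P b p) :=
  measurable_const.max (stronglyMeasurable_condExp.measurable.min measurable_const)

lemma isRepresentation_predApprox (𝔸 : SetFiltration U) (P : Measure[𝔸.sigma] Ω)
    (b : BddFun (Ω × I)) (d : DisjFamily U) :
    IsRepresentation 𝔸 (predApprox 𝔸 P d b : Ω × I → ℝ) d (predCoeff 𝔸 P b) := by
  refine ⟨fun p _ => ⟨⟨_, predCoeff_abs_le 𝔸 P b p⟩,
    (measurable_predCoeff 𝔸 P b p).mono (𝔸.le_sigma _) le_rfl⟩, ?_⟩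
  ext x
  simp [predApprox]

/-- On a nonempty fibre the infimum is that of a constant; on an empty one the default value `0`
applies, which produces the indicator of the projection. -/
lemma fiberInf_lift (k : BddFun Ω) (D : Set (Ω × I)) :
    fiberInf (lift I k : Ω × I → ℝ) D = (proj D).indicator (k : Ω → ℝ) := by
  ext ω
  by_cases h : ω ∈ proj D
  · obtain ⟨i, hi⟩ := Set.mem_iUnion.1 h
    have : Nonempty {i : I // (ω, i) ∈ D} := ⟨⟨i, hi⟩⟩
    simp [fiberInf, lift_apply, h]
  · have : IsEmpty {i : I // (ω, i) ∈ D} := ⟨fun i => h (Set.mem_iUnion.2 ⟨i.1, i.2⟩)⟩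
    simp [fiberInf, h]

/-- If `k` has vanishing conditional expectation given `𝔸_u`, its approximate projections vanish on
the sets `s \ t` disjoint from `u`. -/
lemma predCoeff_lift_ae_eq_zero (𝔸 : SetFiltration U) (P : Measure[𝔸.sigma] Ω)
    [IsProbabilityMeasure P] {k : BddFun Ω} (hk : Measurable[𝔸.sigma] (k : Ω → ℝ)) {u : U}
    (hk0 : P[(k : Ω → ℝ) | 𝔸.alg u] =ᵐ[P] 0) {p : U × U}
    (hp : diff p ⊆ (u : Set (Ω × I))ᶜ) : predCoeff 𝔸 P (lift I k) p =ᵐ[P] 0 := by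
  obtain ⟨C, hC⟩ := k.2
  have hkint : Integrable (k : Ω → ℝ) P :=
    Integrable.of_bound hk.aestronglyMeasurable C (ae_of_all _ hC)
  have hproj : MeasurableSet[𝔸.alg p.1] (proj (diff p)) := by
    have := (𝔸.proj_mem p.1 p.2 Set.univ MeasurableSet.univ).1
    rwa [Set.univ_inter] at this
  have hproj' := 𝔸.le_sigma _ _ hproj
  have hsub : proj (diff p) ⊆ proj ((p.1 : Set (Ω × I)) \ u) :=
    Set.iUnion_mono fun i ω hω => ⟨hω.1, hp hω⟩
  have hce : (0 : Ω → ℝ) =ᵐ[P] P[fiberInf (lift I k : Ω × I → ℝ) (diff p) | 𝔸.alg p.1] := by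
    rw [fiberInf_lift]
    refine ae_eq_condExp_of_forall_setIntegral_eq (𝔸.le_sigma _) (hkint.indicator hproj')
      (fun _ _ _ => integrableOn_zero) (fun G hG _ => ?_) aestronglyMeasurable_zero
    -- Since `diff p` avoids `u`, its projection lies in that of `p.1 \ u`. The compatibility axiom
    -- for the pair `(p.1, u)` then moves the set from `𝔸.alg p.1` into `𝔸.alg u`, where `k`
    -- integrates to zero.
    have hGu : MeasurableSet[𝔸.alg u] (G ∩ proj (diff p)) := by
      have := (𝔸.proj_mem p.1 u _
        (@MeasurableSet.inter _ (𝔸.alg p.1) _ _ hG hproj)).2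
      rwa [Set.inter_assoc, Set.inter_eq_left.2 hsub] at this
    rw [setIntegral_indicator hproj', ← setIntegral_condExp (𝔸.le_sigma u) hkint hGu,
      setIntegral_congr_ae (g := fun _ => (0 : ℝ)) (𝔸.le_sigma u _ hGu)
        (hk0.mono fun ω h _ => h)]
    simp
  have h0 : (0 : ℝ) ≤ ⨆ x, |(lift I k : Ω × I → ℝ) x| := Real.iSup_nonneg fun _ => abs_nonneg _
  filter_upwards [hce] with ω hω
  simp only [predCoeff, ← hω, Pi.zero_apply, min_eq_left h0]
  exact max_eq_right (by linarith)

/-- A compensator charges `(Ω × I) \ u` compatibly with the conditional expectation given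
`𝔸_u`. -/
lemma IsCompensator.restrict_compl_eq_zero (hU : IsIndexLattice U) {𝔸 : SetFiltration U}
    {LIM : BanachLimit U} {P : Measure[𝔸.sigma] Ω} [IsProbabilityMeasure P]
    {lam L : PosBa (Ω × I)} (hL : IsCompensator 𝔸 LIM P lam L) (u : U) {k : BddFun Ω}
    (hk : Measurable[𝔸.sigma] (k : Ω → ℝ)) (hk0 : P[(k : Ω → ℝ) | 𝔸.alg u] =ᵐ[P] 0) :
    L.restrict (u : Set (Ω × I))ᶜ k = 0 := by
  obtain ⟨hb, heq⟩ := hL.lim_eq (lift I k) (ind (u : Set (Ω × I))ᶜ)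
    (isElementaryStar_lift hU 𝔸 hk) (isElementary_ind_compl hU 𝔸 u)
  rw [PosBa.restrict_apply, heq]
  refine LIM.lim_eq _ 0 (tendsto_const_nhds.congr' ?_)
  -- For `d` refining the complement of `u`, the members in `e` lie in that complement and have
  -- almost surely zero coefficients. The other members are disjoint from those in `e`, hence from
  -- the complement. The net is thus eventually zero.
  filter_upwards [eventually_ge_atTop (complFamily hU u)] with d hd
  obtain ⟨e, he, hdiff⟩ := hd _ (Finset.mem_singleton_self _)
  rw [diff, ← Set.compl_eq_univ_sdiff] at hdiff
  change 0 = L (predApprox 𝔸 P d (lift I k) * ind (u : Set (Ω × I))ᶜ)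
  rw [predApprox, Finset.sum_mul, map_sum]
  refine (Finset.sum_eq_zero fun p hp => ?_).symm
  by_cases hpe : p ∈ e
  · have hsub : diff p ⊆ (u : Set (Ω × I))ᶜ := by
      rw [hdiff]
      exact Set.subset_biUnion_of_mem (u := fun q => diff q) hpe
    have hm : MeasurableSet[𝔸.sigma] {ω | predCoeff 𝔸 P (lift I k) p ω ≠ 0} :=
      ((measurable_predCoeff 𝔸 P _ p).mono (𝔸.le_sigma _) le_rfl)
        (measurableSet_singleton (0 : ℝ)).compl
    refine L.eq_zero_of_null
      (hL.null _ hm (ae_iff.1 (predCoeff_lift_ae_eq_zero 𝔸 P hk hk0 hsub))) fun x hx => ?_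
    have hx0 : predCoeff 𝔸 P (lift I k) p x.1 = 0 := by simpa using hx
    change (diff p).indicator (fun x => predCoeff 𝔸 P (lift I k) p x.1) x *
      (u : Set (Ω × I))ᶜ.indicator (1 : Ω × I → ℝ) x = 0
    by_cases hxp : x ∈ diff p <;> simp [hxp, hx0]
  · convert map_zero L using 2
    apply Subtype.ext
    ext x
    change (diff p).indicator (fun x => predCoeff 𝔸 P (lift I k) p x.1) x *
      (u : Set (Ω × I))ᶜ.indicator (1 : Ω × I → ℝ) x = 0
    by_cases hx : x ∈ diff p
    · have : x ∉ (u : Set (Ω × I))ᶜ := by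
        rw [hdiff]
        intro hx'
        obtain ⟨q, hq, hxq⟩ := Set.mem_iUnion₂.1 hx'
        have hne : p ≠ q := fun h => hpe (h ▸ hq)
        exact Set.disjoint_left.1 (d.2.2 hp (he hq) hne) hx hxq
      rw [Set.indicator_of_notMem this, mul_zero]
    · rw [Set.indicator_of_notMem hx, zero_mul]

/-! ### Processes with a given associated functional -/

/-- `∫ h A_u dP = L(h 1_{uᶜ})` for all bounded `𝓕`-measurable `h`. -/
def IsDensityProcess (𝔸 : SetFiltration U) (P : Measure[𝔸.sigma] Ω) (L : PosBa (Ω × I))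
    (A : U → Ω → ℝ) : Prop :=
  ∀ (u : U) (h : BddFun Ω), Measurable[𝔸.sigma] (h : Ω → ℝ) →
    ∫ ω, (h : Ω → ℝ) ω * A u ω ∂P = L.restrict (u : Set (Ω × I))ᶜ h

lemma integrable_elemIntegral_term {𝔸 : SetFiltration U} {P : Measure[𝔸.sigma] Ω}
    {A : U → Ω → ℝ} (hA : ∀ u, Integrable (A u) P) {c : Ω → ℝ} (hc : c ∈ BddFun Ω)
    (hcm : Measurable[𝔸.sigma] c) (p : U × U) :
    Integrable (fun ω => c ω * (A p.2 ω - A p.1 ω)) P := by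
  obtain ⟨C, hC⟩ := hc
  exact ((hA _).sub (hA _)).bdd_mul hcm.aestronglyMeasurable (ae_of_all _ hC)

lemma integral_elemIntegral {𝔸 : SetFiltration U} {P : Measure[𝔸.sigma] Ω}
    {A : U → Ω → ℝ} (hA : ∀ u, Integrable (A u) P) {d : DisjFamily U} {c : U × U → Ω → ℝ}
    (hc : ∀ p ∈ d.1, c p ∈ BddFun Ω ∧ Measurable[𝔸.sigma] (c p)) :
    ∫ ω, elemIntegral d c A ω ∂P = ∑ p ∈ d.1, ∫ ω, c p ω * (A p.2 ω - A p.1 ω) ∂P :=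
  integral_finsetSum _ fun p hp => integrable_elemIntegral_term hA (hc p hp).1 (hc p hp).2 p

/-- For `v ⊆ u` the indicator of `u \ v` is the difference of those of `vᶜ` and `uᶜ`, so the
identity holds term by term. It turns naturality into a statement about `L` and shows that the
integral does not depend on the representation. -/
lemma IsDensityProcess.integral_elemIntegral_eq {𝔸 : SetFiltration U} {P : Measure[𝔸.sigma] Ω}
    {L : PosBa (Ω × I)} {A : U → Ω → ℝ} (hAL : IsDensityProcess 𝔸 P L A)
    (hA : ∀ u, Integrable (A u) P) {d : DisjFamily U} {c : U × U → Ω → ℝ} (f : BddFun (Ω × I))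
    (hf : IsRepresentation 𝔸 (f : Ω × I → ℝ) d c) :
    ∫ ω, elemIntegral d c A ω ∂P = L f := by
  classical
  -- Coefficients off `d` may be unbounded; there `0` is substituted.
  have hex : ∀ p, ∃ g : BddFun Ω, p ∈ d.1 → (g : Ω → ℝ) = c p := fun p => by
    by_cases hp : p ∈ d.1
    · exact ⟨⟨c p, (hf.1 p hp).1⟩, fun _ => rfl⟩
    · exact ⟨0, fun h => absurd h hp⟩
  choose g hg using hex
  have hfg : f = ∑ p ∈ d.1, lift I (g p) * ind (diff p) := by
    apply Subtype.ext
    rw [hf.2]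
    ext x
    simp only [AddSubmonoidClass.coe_finsetSum, Finset.sum_apply]
    refine Finset.sum_congr rfl fun p hp => ?_
    change _ = (g p : Ω → ℝ) x.1 * (diff p).indicator 1 x
    rw [hg p hp]
    by_cases hx : x ∈ diff p <;> simp [hx]
  rw [integral_elemIntegral hA hf.1, hfg, map_sum]
  refine Finset.sum_congr rfl fun p hp => ?_
  have hgm : Measurable[𝔸.sigma] (g p : Ω → ℝ) := by
    rw [hg p hp]
    exact (hf.1 p hp).2
  obtain ⟨C, hC⟩ := (g p).2
  have hi : ∀ u, Integrable (fun ω => (g p : Ω → ℝ) ω * A u ω) P := fun u =>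
    (hA u).bdd_mul hgm.aestronglyMeasurable (ae_of_all _ hC)
  have hind : ind (diff p) = ind (p.2 : Set (Ω × I))ᶜ - ind (p.1 : Set (Ω × I))ᶜ := by
    apply Subtype.ext
    ext x
    change (diff p).indicator (1 : Ω × I → ℝ) x =
      (p.2 : Set (Ω × I))ᶜ.indicator 1 x - (p.1 : Set (Ω × I))ᶜ.indicator 1 x
    have hsub := @d.2.1 p hp x
    by_cases h1 : x ∈ (p.1 : Set (Ω × I)) <;> by_cases h2 : x ∈ (p.2 : Set (Ω × I)) <;>
      simp_all [diff]
  rw [hind, mul_sub, map_sub, ← PosBa.restrict_apply, ← PosBa.restrict_apply, ← hAL _ _ hgm,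
    ← hAL _ _ hgm, ← integral_sub (hi _) (hi _), ← hg p hp]
  simp only [mul_sub]

lemma setIntegral_eq_integral_ind_mul {S : Type*} {m0 : MeasurableSpace S} (P : Measure S)
    {F : Set S} (hF : MeasurableSet F) (g : S → ℝ) :
    ∫ ω in F, g ω ∂P = ∫ ω, (ind F : S → ℝ) ω * g ω ∂P := by
  rw [← integral_indicator hF]
  exact integral_congr_ae (ae_of_all _ fun x => by by_cases hx : x ∈ F <;> simp [coe_ind, hx])

lemma measurable_ind {S : Type*} {m0 : MeasurableSpace S} {F : Set S} (hF : MeasurableSet F) :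
    Measurable (ind F : S → ℝ) :=
  measurable_one.indicator hF

lemma IsDensityProcess.setIntegral_eq {𝔸 : SetFiltration U} {P : Measure[𝔸.sigma] Ω}
    {L : PosBa (Ω × I)} {A : U → Ω → ℝ} (hAL : IsDensityProcess 𝔸 P L A) (u : U) {F : Set Ω}
    (hF : MeasurableSet[𝔸.sigma] F) :
    ∫ ω in F, A u ω ∂P = L (ind ((F ×ˢ (Set.univ : Set I)) ∩ (u : Set (Ω × I))ᶜ)) := by
  rw [setIntegral_eq_integral_ind_mul P hF, hAL u _ (measurable_ind hF), PosBa.restrict_ind]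

lemma IsDensityProcess.isIncreasing {𝔸 : SetFiltration U} {P : Measure[𝔸.sigma] Ω}
    [IsProbabilityMeasure P] {L : PosBa (Ω × I)} {A : U → Ω → ℝ}
    (hAL : IsDensityProcess 𝔸 P L A) (hA : ∀ u, Integrable (A u) P) :
    IsIncreasingProcess 𝔸 P A := by
  -- Integrated over `F`, the inequality is monotonicity of `L` on `(F × I) ∩ uᶜ ⊆ (F × I) ∩ vᶜ`.
  have hmono : ∀ u v : U, (v : Set (Ω × I)) ⊆ u → A u ≤ᵐ[P] A v := fun u v huv =>
    ae_le_of_forall_setIntegral_le (hA u) (hA v) fun F hF _ => by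
      rw [hAL.setIntegral_eq u hF, hAL.setIntegral_eq v hF]
      exact L.ind_mono (Set.inter_subset_inter_right _ (Set.compl_subset_compl.2 huv))
  intro w u v hw huv
  have h0 : A w =ᵐ[P] 0 := by
    refine (hA w).ae_eq_of_forall_setIntegral_eq _ _ (integrable_zero _ _ _) fun F hF _ => ?_
    rw [hAL.setIntegral_eq w hF, hw, Set.compl_univ, Set.inter_empty,
      show ind (∅ : Set (Ω × I)) = 0 from Subtype.ext (Set.indicator_empty _), map_zero]
    simp
  filter_upwards [h0, hmono w u (hw ▸ Set.subset_univ _), hmono u v huv] with ω h1 h2 h3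
  exact ⟨h1.symm, h2, h3⟩

/-! ### Existence and uniqueness -/

lemma IsCompensator.exists_isDoobMeyer (hU : IsIndexLattice U) {𝔸 : SetFiltration U}
    {LIM : BanachLimit U} {P : Measure[𝔸.sigma] Ω} [IsProbabilityMeasure P]
    {lam L : PosBa (Ω × I)} {m : FinAddProcess 𝔸} (hL : IsCompensator 𝔸 LIM P lam L)
    (hm : IsDoleansMeasure m L) (hca : HasCountablyAdditiveMarginal 𝔸 L) :
    ∃ (M : Ω → ℝ) (A : U → Ω → ℝ), IsDoobMeyer LIM m P M A := by
  obtain ⟨M, -, hMi, hM⟩ := PosBa.exists_restrict_density hca hL.null Set.univ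
  choose B _ hBi hB using fun u : U =>
    PosBa.exists_restrict_density hca hL.null (u : Set (Ω × I))ᶜ
  -- Adaptedness up to null sets; passing to the conditional expectation then gives exact `𝔸.alg
  -- u`-measurability.
  have hBA : ∀ u, B u =ᵐ[P] P[B u | 𝔸.alg u] := fun u =>
    ae_eq_condExp_of_orthogonal (𝔸.le_sigma u) (hBi u) fun k hk hk0 => by
      rw [← hB u k hk]
      exact hL.restrict_compl_eq_zero hU u hk hk0
  have hAi : ∀ u, Integrable (P[B u | 𝔸.alg u]) P := fun u => integrable_condExp
  have hAL : IsDensityProcess 𝔸 P L fun u => P[B u | 𝔸.alg u] := fun u h hh => by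
    rw [hB u h hh]
    exact integral_congr_ae ((hBA u).mono fun ω hω => by simp only [hω])
  refine ⟨M, fun u => P[B u | 𝔸.alg u], hMi, hAi,
    fun u => stronglyMeasurable_condExp.measurable, hAL.isIncreasing hAi, fun f hf => ?_,
    fun u F hF => ?_⟩
  · obtain ⟨hb, heq⟩ := hL.lim_eq f 1 hf (isElementary_one hU 𝔸)
    have hnet : (fun d : DisjFamily U => ∫ ω, elemIntegral d (predCoeff 𝔸 P f)
        (fun u => P[B u | 𝔸.alg u]) ω ∂P) = fun d => L (predApprox 𝔸 P d f * 1) := by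
      ext d
      rw [mul_one]
      exact hAL.integral_elemIntegral_eq hAi _ (isRepresentation_predApprox 𝔸 P f d)
    refine ⟨hnet ▸ hb, fun d c hc => ?_⟩
    rw [mul_one] at heq
    rw [hAL.integral_elemIntegral_eq hAi f hc, heq]
    exact congrArg LIM.lim (Subtype.ext hnet.symm)
  · have hF' := 𝔸.le_sigma u F hF
    rw [integral_indicator hF', integral_sub hMi.integrableOn (hAi u).integrableOn,
      hAL.setIntegral_eq u hF', setIntegral_eq_integral_ind_mul P hF',
      ← hM _ (measurable_ind hF'), PosBa.restrict_ind, ← hm u F hF, ← map_sub]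
    congr 1
    apply Subtype.ext
    ext x
    change _ = Set.indicator _ (1 : Ω × I → ℝ) x - Set.indicator _ (1 : Ω × I → ℝ) x
    by_cases h1 : x.1 ∈ F <;> by_cases h2 : x ∈ (u : Set (Ω × I)) <;> simp [coe_ind, h1, h2]

/-- The integrals of bounded `𝔸_u`-measurable functions against the increment of `A` over `u \ v`
are determined by the supermartingale. -/
lemma IsDoobMeyer.integral_mul_increment_eq {𝔸 : SetFiltration U} {LIM : BanachLimit U}
    {m : FinAddProcess 𝔸} {P : Measure[𝔸.sigma] Ω} [IsProbabilityMeasure P] {M M' : Ω → ℝ}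
    {A A' : U → Ω → ℝ} (h : IsDoobMeyer LIM m P M A) (h' : IsDoobMeyer LIM m P M' A')
    {u v : U} (huv : (v : Set (Ω × I)) ⊆ u) {c : Ω → ℝ} (hc : c ∈ BddFun Ω)
    (hcm : Measurable[𝔸.alg u] c) :
    ∫ ω, c ω * (A v ω - A u ω) ∂P = ∫ ω, c ω * (A' v ω - A' u ω) ∂P := by
  obtain ⟨C, hC⟩ := hc
  have hci : Integrable c P := Integrable.of_bound
    (hcm.mono (𝔸.le_sigma u) le_rfl).aestronglyMeasurable C (ae_of_all _ hC)
  -- As `F` belongs to both `𝔸.alg u` and `𝔸.alg v`, the two decompositions can be subtracted and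
  -- the martingale part `N` cancels.
  have hset : ∀ {N : Ω → ℝ} {X : U → Ω → ℝ}, IsDoobMeyer LIM m P N X →
      ∀ F : Set Ω, MeasurableSet[𝔸.alg u] F →
        ∫ ω in F, (X v ω - X u ω) ∂P = m.toFun u F - m.toFun v F := fun {N X} hX F hF => by
    rw [hX.decomp u F hF, hX.decomp v F (𝔸.mono u v huv F hF),
      integral_indicator (𝔸.le_sigma u F hF), integral_indicator (𝔸.le_sigma u F hF),
      ← integral_sub (f := fun ω => N ω - X u ω) (g := fun ω => N ω - X v ω)
        (hX.integrable_M.sub (hX.integrable_A u)).integrableOn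
        (hX.integrable_M.sub (hX.integrable_A v)).integrableOn]
    exact integral_congr_ae (ae_of_all _ fun ω => by ring)
  have hXi := (h.integrable_A v).sub (h.integrable_A u)
  have hYi := (h'.integrable_A v).sub (h'.integrable_A u)
  have hce : P[A v - A u | 𝔸.alg u] =ᵐ[P] P[A' v - A' u | 𝔸.alg u] :=
    ae_eq_condExp_of_forall_setIntegral_eq (𝔸.le_sigma u) hYi
      (fun _ _ _ => integrable_condExp.integrableOn)
      (fun F hF _ => by
        rw [setIntegral_condExp (𝔸.le_sigma u) hXi hF]
        exact (hset h F hF).trans (hset h' F hF).symm)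
      stronglyMeasurable_condExp.aestronglyMeasurable
  have hcond : ∀ X : Ω → ℝ, Integrable X P →
      ∫ ω, c ω * X ω ∂P = ∫ ω, c ω * (P[X | 𝔸.alg u]) ω ∂P := fun X hX => by
    rw [← integral_condExp_mul_comm (𝔸.le_sigma u) hX hci (ae_of_all _ hC),
      condExp_of_stronglyMeasurable (𝔸.le_sigma u) hcm.stronglyMeasurable hci]
  exact (hcond _ hXi).trans
    ((integral_congr_ae (hce.mono fun ω hω => by simp only [hω])).trans (hcond _ hYi).symm)

/-- Naturality for `1_F 1_{uᶜ}` expresses the integral of `A u` over `F` as a Banach limit. Each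
entry of its net pairs the increment over some `s \ t` with an `𝔸.alg s`-measurable coefficient, so
it is determined by `m`. -/
lemma IsDoobMeyer.unique_A (hU : IsIndexLattice U) {𝔸 : SetFiltration U} {LIM : BanachLimit U}
    {m : FinAddProcess 𝔸} {P : Measure[𝔸.sigma] Ω} [IsProbabilityMeasure P] {M M' : Ω → ℝ}
    {A A' : U → Ω → ℝ} (h : IsDoobMeyer LIM m P M A) (h' : IsDoobMeyer LIM m P M' A') (u : U) :
    A u =ᵐ[P] A' u := by
  set w : U := ⟨Set.univ, hU.univ_mem⟩
  refine (h.integrable_A u).ae_eq_of_forall_setIntegral_eq _ _ (h'.integrable_A u)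
    fun F hF _ => ?_
  have hrep : IsRepresentation 𝔸 (lift I (ind F) * ind (u : Set (Ω × I))ᶜ : BddFun (Ω × I))
      (complFamily hU u) (fun _ => ind F) := by
    refine ⟨fun _ _ => ⟨(ind F).2, measurable_ind hF⟩, ?_⟩
    ext x
    change (ind F : Ω → ℝ) x.1 * (u : Set (Ω × I))ᶜ.indicator 1 x = _
    by_cases hx : x ∈ (u : Set (Ω × I)) <;> simp [complFamily, diff, hx]
  have hint : ∀ {N : Ω → ℝ} {X : U → Ω → ℝ}, IsDoobMeyer LIM m P N X →
      ∫ ω, elemIntegral (complFamily hU u) (fun _ => ind F) X ω ∂P = ∫ ω in F, X u ω ∂P := by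
    intro N X hX
    rw [setIntegral_eq_integral_ind_mul P hF]
    -- The initial value `X w` vanishes almost surely, so the increment over the complement of `u`
    -- is `X u`.
    refine integral_congr_ae ((hX.increasing w w w rfl subset_rfl).mono fun ω hω => ?_)
    change elemIntegral (complFamily hU u) (fun _ => ind F) X ω = _
    simp only [elemIntegral, complFamily, Finset.sum_singleton]
    rw [show X ⟨Set.univ, hU.univ_mem⟩ ω = 0 from hω.1.symm, sub_zero]
  have hstar := isElementaryStar_lift_mul_ind_compl (I := I) hU 𝔸 (measurable_ind hF) u
  obtain ⟨hb, hn⟩ := h.natural _ hstar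
  obtain ⟨hb', hn'⟩ := h'.natural _ hstar
  rw [← hint h, ← hint h', hn _ _ hrep, hn' _ _ hrep]
  congr 1
  apply Subtype.ext
  ext d
  have hc := (isRepresentation_predApprox 𝔸 P
    (lift I (ind F) * ind (u : Set (Ω × I))ᶜ : BddFun (Ω × I)) d).1
  change ∫ ω, elemIntegral d _ A ω ∂P = ∫ ω, elemIntegral d _ A' ω ∂P
  rw [integral_elemIntegral h.integrable_A hc, integral_elemIntegral h'.integrable_A hc]
  exact Finset.sum_congr rfl fun p hp => h.integral_mul_increment_eq h' (d.2.1 p hp) (hc p hp).1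
    (measurable_predCoeff 𝔸 P _ p)

/-- The empty set is the last index, so its σ-algebra contains all the others and hence `𝔸.sigma`.
The decomposition at this index, where `m` is null, can be tested on every set of `𝔸.sigma`. -/
lemma IsDoobMeyer.ae_eq_A_empty (hU : IsIndexLattice U) {𝔸 : SetFiltration U}
    {LIM : BanachLimit U} {m : FinAddProcess 𝔸} {P : Measure[𝔸.sigma] Ω} [IsProbabilityMeasure P]
    {M : Ω → ℝ} {A : U → Ω → ℝ} (h : IsDoobMeyer LIM m P M A) :
    M =ᵐ[P] A ⟨∅, hU.empty_mem⟩ := by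
  refine h.integrable_M.ae_eq_of_forall_setIntegral_eq _ _ (h.integrable_A _) fun F hF _ => ?_
  have hF' : MeasurableSet[𝔸.alg ⟨∅, hU.empty_mem⟩] F :=
    (iSup_le fun s => 𝔸.mono s ⟨∅, hU.empty_mem⟩ (Set.empty_subset _) :
      𝔸.sigma ≤ 𝔸.alg ⟨∅, hU.empty_mem⟩) F hF
  have h0 := h.decomp ⟨∅, hU.empty_mem⟩ F hF'
  rw [m.null_empty _ rfl F hF', integral_indicator hF,
    integral_sub h.integrable_M.integrableOn (h.integrable_A _).integrableOn] at h0
  linarith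

end Filtration

end SetIndexed

end

open SetIndexed
theorem theorem2 {Ω I : Type*} {U : Set (Set (Ω × I))} (hU : IsIndexLattice U)
    (𝔸 : SetFiltration U) (LIM : BanachLimit U) (m : FinAddProcess 𝔸)
    (hm : m.IsSupermartingale) (hD : m.IsClassDStar LIM) :
    ∃ P : Measure[𝔸.sigma] Ω, IsProbabilityMeasure P ∧
      ∃ (M : Ω → ℝ) (A : U → Ω → ℝ), IsDoobMeyer LIM m P M A ∧
        ∀ (M' : Ω → ℝ) (A' : U → Ω → ℝ), IsDoobMeyer LIM m P M' A' →
          (∀ u : U, A u =ᵐ[P] A' u) ∧ M =ᵐ[P] M' := by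
  obtain ⟨lam, L, P, hP, -, -, hcomp, hLm, hca⟩ := hD
  obtain ⟨M, A, h⟩ := hcomp.exists_isDoobMeyer hU hLm hca
  exact ⟨P, hP, M, A, h, fun M' A' h' => ⟨fun u => h.unique_A hU h' u,
    (h.ae_eq_A_empty hU).trans ((h.unique_A hU h' _).trans (h'.ae_eq_A_empty hU).symm)⟩⟩
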